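/- Let $\mathbb S\subset\mathbb R$ be a finite set and let $\boldsymbol G=(G(x,y))_{x,y\in\mathbb S}$ be a transition rate matrix, i.e. $G(x,y)\ge 0$ for $x\ne y$ and $G(x,x)=-\sum_{y\ne x}G(x,y)$. Let $Y=(Y_t)_{t\ge 0}$ be a continuous-time Markov chain with c\`adl\`ag paths, state space $\mathbb S$, rate matrix $\boldsymbol G$ (transition function $e^{t\boldsymbol G}$), and let $a>0$. (The chain may, but need not, be absorbed at $\min\mathbb S$ and $\max\mathbb S$.) For $x,y\in\mathbb S$, write $\mathbb E[\,\cdot\mid Y_0=x,\overline Y_0=y]$ for the expectation when the chain starts at $x$ and its running maximum is initialised at $y$, that is, $\overline Y_t=\max\{y,\sup_{0\le u\le t}Y_u\}$ for $t\ge 0$ (so the initial running maximum is $y$ when $x\le y$, and is $x$ when $x>y$). Write $\overline Y_{s,t}=\sup_{s\le u\le t}Y_u$. The drawdown times with recovery are $\tau_{a,0}=0$ and $$\tau_{a,n}=\inf\{t>\tau_{a,n-1}:\ \overline Y_t-Y_t\ge a,\ \overline Y_{\tau_{a,n-1},t}\ge\overline Y_{\tau_{a,n-1}}\},\qquad n\ge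 1,$$ with $\inf\emptyset=\infty$ and $\tau_{a,n}=\infty$ if $\tau_{a,n-1}=\infty$. For $A\subseteq\mathbb R$ let $T_A=\inf\{t>0: Y_t\notin A\}$ and, for $f:\mathbb S\to\mathbb C$, $$P_A(q,x;f)=\mathbb E\big[e^{-qT_A}\mathbf 1_{\{T_A<\infty\}}f(Y_{T_A})\,\big|\,Y_0=x\big].$$ Let $q\in\mathbb C$ with $\Re(q)>0$ (and $e^{-q\cdot\infty}:=0$). Then, for all $x,y\in\mathbb S$, the random variables $e^{-q\tau_{a,k}}$ ($k\ge1$) are integrable, the series $$J(q,x,y)=\sum_{k=1}^\infty\mathbb E\big[e^{-q\tau_{a,k}}\,\big|\,Y_0=x,\overline Y_0=y\big]$$ converges absolutely, and $$J(q,x,y)=\sum_{z\in\mathbb S,\,z\ge y}P_{(-\infty,y)}(q,x;\mathbf 1_{\{\cdot=z\}})\,J(q,z,z),$$ $$J(q,y,y)=\sum_{z\in\mathbb S,\,z\le y-a}P_{(y-a,y]}(q,y;\mathbf 1_{\{\cdot=z\}})\,\big(1+J(q,z,y)\big)+\sum_{z\in\mathbb S,\,z>y}P_{(y-a,y]}(q,y;\mathbf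 1_{\{\cdot=z\}})\,J(q,z,z).$$ -/

import Mathlib

open MeasureTheory Set Filter Topology
open scoped NNReal ENNReal

noncomputable section

/-- Transition rate matrix on the finite set `S` of reals: nonnegative off-diagonal entries and
zero row sums. -/
structure IsRateMatrix {S : Finset ℝ} (G : Matrix S S ℝ) : Prop where
  nonneg_off_diag : ∀ x y : S, x ≠ y → 0 ≤ G x y
  diag : ∀ x : S, G x x = -∑ y ∈ Finset.univ.erase x, G x y

/-- `Y`, together with the laws `P x` (the chain started from `x`), is a time-homogeneous
continuous-time Markov chain with state space `S`, transition rate matrix `G` and càdlàg paths: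
given the past up to time `s`, the state at time `s + t` is distributed according to the row of
`exp (t G)` indexed by the state at time `s`. -/
structure IsCTMC {Ω : Type*} [MeasurableSpace Ω] {S : Finset ℝ} (G : Matrix S S ℝ)
    (P : S → Measure Ω) (Y : ℝ≥0 → Ω → S) : Prop where
  prob : ∀ x : S, IsProbabilityMeasure (P x)
  measurable : ∀ t : ℝ≥0, Measurable (Y t)
  right_continuous : ∀ (ω : Ω) (t : ℝ≥0), ContinuousWithinAt (fun s => Y s ω) (Ici t) t
  left_limits : ∀ (ω : Ω) (t : ℝ≥0), ∃ l : S, Tendsto (fun s => Y s ω) (𝓝[<] t) (𝓝 l)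
  start : ∀ x : S, ∀ᵐ ω ∂(P x), Y 0 ω = x
  markov : ∀ (x : S) (s t : ℝ≥0) (A : Set Ω),
    MeasurableSet[⨆ u ∈ Iic s, MeasurableSpace.comap (Y u) inferInstance] A →
    ∀ y z : S,
      (P x).real (A ∩ {ω | Y s ω = y} ∩ {ω | Y (s + t) ω = z}) =
        (P x).real (A ∩ {ω | Y s ω = y}) * NormedSpace.exp ((t : ℝ) • G) y z

/-- First passage time `T_A = inf {t > 0 : w t ∉ A}` of a path `w` (`∞` if there is none). -/
def firstPassage (A : Set ℝ) (w : ℝ≥0 → ℝ) : ℝ≥0∞ :=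
  sInf {T : ℝ≥0∞ | ∃ t : ℝ≥0, 0 < t ∧ w t ∉ A ∧ T = t}

/-- `P_A(k, x; f) = E_x[exp (-∫_0^{T_A} k(Y_s) ds) 1_{T_A < ∞} f(Y_{T_A})]`. -/
def passageTransform {Ω : Type*} [MeasurableSpace Ω] {S : Finset ℝ}
    (P : S → Measure Ω) (Y : ℝ≥0 → Ω → S) (A : Set ℝ) (k : S → ℂ) (x : S) (f : S → ℂ) : ℂ :=
  ∫ ω, (let T := firstPassage A (fun t => (Y t ω : ℝ))
    if T = ∞ then 0
    else Complex.exp (-∫ s in (0 : ℝ)..T.toReal, k (Y s.toNNReal ω)) * f (Y T.toNNReal ω)) ∂(P x)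

/-- `sup_{s ≤ u ≤ t} w u`. -/
def supBetween (w : ℝ≥0 → ℝ) (s t : ℝ≥0) : ℝ := sSup (w '' Icc s t)

/-- Running maximum at time `t` of the path `w`, when the running maximum is initialised at `y`
at time `0`. -/
def runningMax (y : ℝ) (w : ℝ≥0 → ℝ) (t : ℝ≥0) : ℝ := max y (supBetween w 0 t)

/-- The `n`-th drawdown time with recovery of the path `w`, for the threshold `a` and the initial
running maximum `y`. After the `(n-1)`-st such time `s`, the path first has to climb back to (or
above) the running maximum attained at `s`; the `n`-th time is the first time thereafter at which
the drawdown is at least `a`. The value is `∞` if there is no such time. -/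
def drawdownTime (a y : ℝ) (w : ℝ≥0 → ℝ) : ℕ → ℝ≥0∞
  | 0 => 0
  | n + 1 => sInf {T : ℝ≥0∞ | ∃ s t : ℝ≥0, drawdownTime a y w n = s ∧ s < t ∧
      a ≤ runningMax y w t - w t ∧ runningMax y w s ≤ supBetween w s t ∧ T = t}

/-- `e^{-qT}`, with the value `0` at `T = ∞`. -/
def discount (q : ℂ) (T : ℝ≥0∞) : ℂ := if T = ∞ then 0 else Complex.exp (-q * (T.toReal : ℂ))

/-- The discount factor `e^{-q τ_{a,n}}` along the chain, the running maximum being started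
at `y`. -/
def drawdownDiscount {Ω : Type*} {S : Finset ℝ} (Y : ℝ≥0 → Ω → S) (a : ℝ) (q : ℂ) (y : S)
    (n : ℕ) (ω : Ω) : ℂ :=
  discount q (drawdownTime a y (fun t => (Y t ω : ℝ)) n)

/-- `J(q, x, y) = ∑_{n ≥ 1} E[e^{-q τ_{a,n}} | Y_0 = x, running maximum at time 0 = y]`. -/
def drawdownSum {Ω : Type*} [MeasurableSpace Ω] {S : Finset ℝ}
    (P : S → Measure Ω) (Y : ℝ≥0 → Ω → S) (a : ℝ) (q : ℂ) (x y : S) : ℂ :=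
  ∑' n : ℕ, ∫ ω, drawdownDiscount Y a q y (n + 1) ω ∂(P x)

/-- The indicator function `1_{· = z}`. -/
def pointIndicator {S : Finset ℝ} (z : S) : S → ℂ := fun u => if u = z then 1 else 0

end

/-!
By the strong Markov property, the chain restarts at a first passage time `T`. Up to the exit
from `(-∞, y)` the running maximum stays at `y` above the path, so no drawdown is counted before
`T`, and every `τ_{a,n}` with `n ≥ 1` is `T` plus the `n`-th drawdown time of the restarted chain,
whose running maximum equals its current state. Started from `y`, the chain leaves `(y - a, y]`
either at the bottom, and then `T` is the first drawdown time while the running maximum is still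
`y`, or at the top, and then no drawdown has occurred and the running maximum is the current state.
Multiplying discount factors turns these restarts into linear relations between the expectations of
`e^{-q τ_{a,n}}`. Since `T > 0`, the weights `P_{(y-a,y]}(q, y; 1_{· = z})` have total mass at most
some `ρ < 1` uniformly in `y`, so the expectations decay geometrically in `n` and the relations can
be summed.
-/

section Dense

variable {ι : Type*} [LinearOrder ι] [TopologicalSpace ι] [OrderTopology ι] [DenselyOrdered ι]
  [NoMaxOrder ι]

theorem exists_iff_exists_mem_dense {D : Set ι} (hD : Dense D) {p : ι → Prop}
    (hp : ∀ t, p t → ∀ᶠ s in 𝓝[≥] t, p s) : (∃ t, p t) ↔ ∃ t ∈ D, p t := by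
  refine ⟨fun ⟨t, ht⟩ => ?_, fun ⟨t, _, ht⟩ => ⟨t, ht⟩⟩
  obtain ⟨r, htr, hr⟩ := mem_nhdsGE_iff_exists_Ico_subset.1 (hp t ht)
  obtain ⟨s, hs, hts, hsr⟩ := hD.exists_between htr
  exact ⟨s, hs, hr ⟨hts.le, hsr⟩⟩

theorem measurableSet_exists_of_eventually_nhdsGE [TopologicalSpace.SeparableSpace ι] {Ω : Type*}
    [MeasurableSpace Ω] {p : Ω → ι → Prop} (hp : ∀ ω t, p ω t → ∀ᶠ s in 𝓝[≥] t, p ω s)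
    (hmeas : ∀ t, MeasurableSet {ω | p ω t}) : MeasurableSet {ω | ∃ t, p ω t} := by
  obtain ⟨D, hDc, hD⟩ := TopologicalSpace.exists_countable_dense ι
  simp only [exists_iff_exists_mem_dense hD (hp _)]
  have hUnion : {ω | ∃ t ∈ D, p ω t} = ⋃ t ∈ D, {ω | p ω t} := by
    ext ω
    simp only [mem_ofPred_eq, mem_iUnion, exists_prop]
  exact hUnion ▸ MeasurableSet.biUnion hDc fun t _ => hmeas t

end Dense

theorem tendsto_add_nhdsGE (r t : ℝ≥0) : Tendsto (fun s => s + t) (𝓝[≥] r) (𝓝[≥] (r + t)) := by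
  refine tendsto_nhdsWithin_iff.2 ⟨?_, ?_⟩
  · exact ((continuous_id.add continuous_const).tendsto r).mono_left nhdsWithin_le_nhds
  · filter_upwards [self_mem_nhdsWithin] with s hs
    exact add_le_add_left hs t

/-- Right-continuity for the discrete topology on the state space: the path stays in each state
for a positive time. Càdlàg paths with values in a finite set have this property. -/
def IsRightLocallyConstant {E : Type*} (w : ℝ≥0 → E) : Prop :=
  ∀ t, ∀ᶠ s in 𝓝[≥] t, w s = w t

namespace IsRightLocallyConstant

variable {E F : Type*} {w : ℝ≥0 → E}

theorem comp (hw : IsRightLocallyConstant w) (f : E → F) :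
    IsRightLocallyConstant fun t => f (w t) :=
  fun t => (hw t).mono fun _ => congrArg f

theorem shift (hw : IsRightLocallyConstant w) (T : ℝ≥0) :
    IsRightLocallyConstant fun t => w (T + t) := fun t => by
  simpa only [add_comm] using (tendsto_add_nhdsGE t T).eventually (hw (t + T))

end IsRightLocallyConstant

section RunningMax

variable {w : ℝ≥0 → ℝ} {y m c : ℝ} {s t u T : ℝ≥0}

theorem le_supBetween (hw : BddAbove (range w)) (hs : s ≤ u) (ht : u ≤ t) :
    w u ≤ supBetween w s t :=
  le_csSup (hw.mono (image_subset_range _ _)) ⟨u, ⟨hs, ht⟩, rfl⟩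

theorem exists_eq_supBetween (hw : (range w).Finite) (h : s ≤ t) :
    ∃ u ∈ Icc s t, w u = supBetween w s t :=
  ((nonempty_Icc.2 h).image w).csSup_mem (hw.subset (image_subset_range _ _))

theorem runningMax_le_iff (hw : BddAbove (range w)) :
    runningMax y w t ≤ c ↔ y ≤ c ∧ ∀ u ≤ t, w u ≤ c := by
  refine max_le_iff.trans (and_congr_right fun _ => ⟨fun h u hu => ?_, fun h => ?_⟩)
  · exact (le_supBetween hw zero_le hu).trans h
  · exact csSup_le ((nonempty_Icc.2 zero_le).image w) (forall_mem_image.2 fun u hu => h u hu.2)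

theorem lt_runningMax_iff (hw : BddAbove (range w)) :
    c < runningMax y w t ↔ c < y ∨ ∃ u ≤ t, c < w u := by
  rw [← not_le, runningMax_le_iff hw]
  push Not
  exact ⟨fun h => (lt_or_ge c y).imp_right h, fun h hy => h.resolve_left hy.not_gt⟩

theorem le_runningMax (hw : BddAbove (range w)) (h : u ≤ t) : w u ≤ runningMax y w t :=
  ((runningMax_le_iff hw).1 le_rfl).2 u h

theorem runningMax_mono (hw : BddAbove (range w)) : Monotone (runningMax y w) := fun _ _ h =>
  (runningMax_le_iff hw).2 ⟨le_max_left _ _, fun _ hv => le_runningMax hw (hv.trans h)⟩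

theorem runningMax_eq_max_of_forall_lt (hw : BddAbove (range w)) (h : ∀ u < T, w u ≤ y) :
    runningMax y w T = max y (w T) := by
  refine le_antisymm ((runningMax_le_iff hw).2 ⟨le_max_left _ _, fun u hu => ?_⟩)
    (max_le (le_max_left _ _) (le_runningMax hw le_rfl))
  rcases hu.lt_or_eq with hu | rfl
  · exact (h u hu).trans (le_max_left _ _)
  · exact le_max_right _ _

theorem runningMax_shift (hw : BddAbove (range w)) (hm : max m (w T) = runningMax y w T)
    (t : ℝ≥0) : runningMax m (fun s => w (T + s)) t = runningMax y w (T + t) := by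
  have hw' : BddAbove (range fun s => w (T + s)) := hw.mono (range_comp_subset_range (T + ·) w)
  refine eq_of_forall_ge_iff fun c => ?_
  have hT : (y ≤ c ∧ ∀ u ≤ T, w u ≤ c) ↔ m ≤ c ∧ w T ≤ c := by
    rw [← runningMax_le_iff hw, ← hm, max_le_iff]
  rw [runningMax_le_iff hw, runningMax_le_iff hw']
  constructor
  · rintro ⟨hm, h⟩
    obtain ⟨hy, h'⟩ := hT.2 ⟨hm, by simpa using h 0 zero_le⟩
    refine ⟨hy, fun u hu => ?_⟩
    rcases le_total u T with huT | hTu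
    · exact h' u huT
    · obtain ⟨v, rfl⟩ := exists_add_of_le hTu
      exact h v (le_of_add_le_add_left hu)
  · rintro ⟨hy, h⟩
    exact ⟨(hT.1 ⟨hy, fun u hu => h u (hu.trans le_self_add)⟩).1,
      fun u hu => h _ (add_le_add_right hu T)⟩

theorem IsRightLocallyConstant.runningMax (hc : IsRightLocallyConstant w)
    (hw : BddAbove (range w)) : IsRightLocallyConstant (runningMax y w) := fun t => by
  obtain ⟨r, htr, hr⟩ := mem_nhdsGE_iff_exists_Ico_subset.1 (hc t)
  filter_upwards [Ico_mem_nhdsGE htr] with s hs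
  refine le_antisymm ((runningMax_le_iff hw).2 ⟨le_max_left _ _, fun u hu => ?_⟩)
    (runningMax_mono hw hs.1)
  rcases le_total u t with hut | htu
  · exact le_runningMax hw hut
  · exact (hr ⟨htu, hu.trans_lt hs.2⟩ : w u = w t).trans_le (le_runningMax hw le_rfl)

end RunningMax

section FirstPassage

variable {A : Set ℝ} {w : ℝ≥0 → ℝ} {c : ℝ≥0∞} {t T : ℝ≥0}

theorem firstPassage_le (h0 : 0 < t) (hA : w t ∉ A) : firstPassage A w ≤ t :=
  sInf_le ⟨t, h0, hA, rfl⟩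

theorem firstPassage_lt_iff : firstPassage A w < c ↔ ∃ t : ℝ≥0, 0 < t ∧ t < c ∧ w t ∉ A := by
  simp only [firstPassage, sInf_lt_iff, mem_ofPred_eq]
  constructor
  · rintro ⟨_, ⟨t, h0, hA, rfl⟩, hc⟩
    exact ⟨t, h0, hc, hA⟩
  · rintro ⟨t, h0, hc, hA⟩
    exact ⟨t, ⟨t, h0, hA, rfl⟩, hc⟩

theorem mem_of_lt_firstPassage (hw : IsRightLocallyConstant w)
    (h : (t : ℝ≥0∞) < firstPassage A w) : w t ∈ A := by
  obtain ⟨c, htc, hc⟩ := ENNReal.lt_iff_exists_nnreal_btwn.1 h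
  have hlt : ∀ᶠ s in 𝓝[>] t, w s = w t ∧ s < c :=
    ((hw t).filter_mono (nhdsWithin_mono t Ioi_subset_Ici_self)).and
      (mem_nhdsWithin_of_mem_nhds (Iio_mem_nhds (ENNReal.coe_lt_coe.1 htc)))
  obtain ⟨s, ⟨hs, hsc⟩, hts⟩ := (hlt.and self_mem_nhdsWithin).exists
  by_contra hA
  exact ((firstPassage_le (zero_le.trans_lt hts) (hs ▸ hA)).trans
    (ENNReal.coe_le_coe.2 hsc.le)).not_gt hc

theorem notMem_of_firstPassage_eq (hw : IsRightLocallyConstant w)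
    (h : firstPassage A w = T) : w T ∉ A := by
  obtain ⟨r, hTr, hr⟩ := mem_nhdsGE_iff_exists_Ico_subset.1 (hw T)
  obtain ⟨t, h0, ht, hA⟩ := firstPassage_lt_iff.1 (h.trans_lt (ENNReal.coe_lt_coe.2 hTr))
  have hTt : (T : ℝ≥0∞) ≤ t := h ▸ firstPassage_le h0 hA
  rwa [← (hr ⟨ENNReal.coe_le_coe.1 hTt, ENNReal.coe_lt_coe.1 ht⟩ : w t = w T)]

theorem firstPassage_pos (hw : IsRightLocallyConstant w) (h : w 0 ∈ A) :
    0 < firstPassage A w := by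
  by_contra h0
  exact notMem_of_firstPassage_eq (T := 0) hw (by simpa using h0) h

end FirstPassage

/-! ### Drawdown times restarted at a first passage -/

/-- The first time at which the drawdown is at least `a` after a visit, not before `d`, of the
path to its running maximum. Iterating this map on `d` yields the drawdown times with recovery
(`drawdownTime_succ`), the recovery condition being expressed by the visit. -/
noncomputable def drawdownTimeFrom (a y : ℝ) (w : ℝ≥0 → ℝ) (d : ℝ≥0∞) : ℝ≥0∞ :=
  sInf {T : ℝ≥0∞ | ∃ u t : ℝ≥0, d ≤ u ∧ u < t ∧ runningMax y w u ≤ w u ∧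
    a ≤ runningMax y w t - w t ∧ T = t}

section DrawdownTimeFrom

variable {a y m : ℝ} {w : ℝ≥0 → ℝ} {c d e τ : ℝ≥0∞}

theorem drawdownTimeFrom_le {u t : ℝ≥0} (hdu : d ≤ u) (hut : u < t)
    (hu : runningMax y w u ≤ w u) (ht : a ≤ runningMax y w t - w t) :
    drawdownTimeFrom a y w d ≤ t :=
  sInf_le ⟨u, t, hdu, hut, hu, ht, rfl⟩

theorem le_drawdownTimeFrom_iff : c ≤ drawdownTimeFrom a y w d ↔
    ∀ u t : ℝ≥0, d ≤ u → u < t → runningMax y w u ≤ w u → a ≤ runningMax y w t - w t → c ≤ t := by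
  refine le_sInf_iff.trans ⟨fun h u t hdu hut hu ht => h _ ⟨u, t, hdu, hut, hu, ht, rfl⟩, ?_⟩
  rintro h _ ⟨u, t, hdu, hut, hu, ht, rfl⟩
  exact h u t hdu hut hu ht

theorem drawdownTimeFrom_lt_iff : drawdownTimeFrom a y w d < c ↔
    ∃ u t : ℝ≥0, d ≤ u ∧ u < t ∧ t < c ∧ runningMax y w u ≤ w u ∧
      a ≤ runningMax y w t - w t := by
  rw [← not_le, le_drawdownTimeFrom_iff]
  push Not
  exact ⟨fun ⟨u, t, h⟩ => ⟨u, t, h.1, h.2.1, h.2.2.2.2, h.2.2.1, h.2.2.2.1⟩,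
    fun ⟨u, t, h⟩ => ⟨u, t, h.1, h.2.1, h.2.2.2.1, h.2.2.2.2, h.2.2.1⟩⟩

theorem le_drawdownTimeFrom : d ≤ drawdownTimeFrom a y w d :=
  le_drawdownTimeFrom_iff.2 fun _ _ hdu hut _ _ => hdu.trans (ENNReal.coe_le_coe.2 hut.le)

theorem drawdownTimeFrom_mono : Monotone (drawdownTimeFrom a y w) := fun _ _ hde =>
  le_drawdownTimeFrom_iff.2 fun _ _ heu hut hu ht => drawdownTimeFrom_le (hde.trans heu) hut hu ht

theorem drawdownTimeFrom_add (hw : BddAbove (range w))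
    (hm : τ ≠ ∞ → max m (w τ.toNNReal) = runningMax y w τ.toNNReal) (d : ℝ≥0∞) :
    drawdownTimeFrom a y w (τ + d) =
      τ + drawdownTimeFrom a m (fun s => w (τ.toNNReal + s)) d := by
  rcases eq_or_ne τ ∞ with rfl | hτ
  · simpa only [top_add, top_le_iff] using le_drawdownTimeFrom (d := ∞)
  lift τ to ℝ≥0 using hτ
  replace hm := hm ENNReal.coe_ne_top
  simp only [ENNReal.toNNReal_coe] at hm ⊢
  refine le_antisymm ?_ (le_drawdownTimeFrom_iff.2 fun u t hdu hut hu ht => ?_)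
  · rw [drawdownTimeFrom.eq_def a m, ENNReal.add_sInf]
    refine le_iInf₂ ?_
    rintro _ ⟨u, t, hdu, hut, hu, ht, rfl⟩
    rw [runningMax_shift hw hm] at hu ht
    rw [← ENNReal.coe_add]
    refine drawdownTimeFrom_le ?_ (add_lt_add_right hut τ) hu ht
    rw [ENNReal.coe_add]
    gcongr
  · obtain ⟨v, rfl⟩ := exists_add_of_le (ENNReal.coe_le_coe.1 (le_self_add.trans hdu))
    obtain ⟨s, rfl⟩ := exists_add_of_le (le_self_add.trans hut.le)
    rw [← runningMax_shift hw hm] at hu ht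
    rw [ENNReal.coe_add, ENNReal.add_le_add_iff_left ENNReal.coe_ne_top] at hdu
    rw [ENNReal.coe_add]
    gcongr
    exact drawdownTimeFrom_le hdu (lt_of_add_lt_add_left hut) hu ht

theorem drawdownTime_succ (ha : 0 < a) (hw : (range w).Finite) (n : ℕ) :
    drawdownTime a y w (n + 1) = drawdownTimeFrom a y w (drawdownTime a y w n) := by
  have hb := hw.bddAbove
  rw [drawdownTime, drawdownTimeFrom]
  congr 1
  ext T
  constructor
  · rintro ⟨s, t, hs, hst, hd, hr, rfl⟩
    obtain ⟨u, hu, hsup⟩ := exists_eq_supBetween hw hst.le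
    have hM : runningMax y w u ≤ w u := by
      rw [hsup, runningMax_le_iff hb]
      refine ⟨(le_max_left _ _).trans hr, fun v hv => ?_⟩
      rcases le_total v s with hvs | hsv
      · exact (le_runningMax hb hvs).trans hr
      · exact le_supBetween hb hsv (hv.trans hu.2)
    have hne : u ≠ t := by
      rintro rfl
      linarith
    exact ⟨u, t, hs ▸ ENNReal.coe_le_coe.2 hu.1, lt_of_le_of_ne hu.2 hne, hM, hd, rfl⟩
  · rintro ⟨u, t, hu, hut, hM, hd, rfl⟩
    lift drawdownTime a y w n to ℝ≥0 using (hu.trans_lt ENNReal.coe_lt_top).ne with s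
    rw [ENNReal.coe_le_coe] at hu
    exact ⟨s, t, rfl, hu.trans_lt hut, hd,
      (runningMax_mono hb hu).trans (hM.trans (le_supBetween hb hu hut.le)), rfl⟩

theorem drawdownTime_add (ha : 0 < a) (hw : (range w).Finite)
    (hm : τ ≠ ∞ → max m (w τ.toNNReal) = runningMax y w τ.toNNReal) {k j : ℕ}
    (hkj : drawdownTime a y w k = τ + drawdownTime a m (fun s => w (τ.toNNReal + s)) j) (n : ℕ) :
    drawdownTime a y w (k + n) =
      τ + drawdownTime a m (fun s => w (τ.toNNReal + s)) (j + n) := by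
  have hshift : (range fun s => w (τ.toNNReal + s)).Finite :=
    hw.subset (range_comp_subset_range (τ.toNNReal + ·) w)
  induction n with
  | zero => exact hkj
  | succ n ih =>
    rw [← add_assoc, drawdownTime_succ ha hw, ih, ← add_assoc, drawdownTime_succ ha hshift,
      drawdownTimeFrom_add hw.bddAbove hm]

theorem drawdownTime_succ_eq_add (ha : 0 < a) (hw : (range w).Finite)
    (hm : τ ≠ ∞ → max m (w τ.toNNReal) = runningMax y w τ.toNNReal)
    (hτ : drawdownTimeFrom a y w 0 = drawdownTimeFrom a y w τ) (n : ℕ) :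
    drawdownTime a y w (n + 1) =
      τ + drawdownTime a m (fun s => w (τ.toNNReal + s)) (n + 1) := by
  have hshift : (range fun s => w (τ.toNNReal + s)).Finite :=
    hw.subset (range_comp_subset_range (τ.toNNReal + ·) w)
  rw [add_comm n]
  refine drawdownTime_add ha hw hm ?_ n
  rw [drawdownTime_succ ha hw, drawdownTime_succ ha hshift, drawdownTime, drawdownTime, hτ,
    ← drawdownTimeFrom_add hw.bddAbove hm, add_zero]

end DrawdownTimeFrom

section Decomposition

variable {a y : ℝ} {w : ℝ≥0 → ℝ}

theorem drawdownTime_succ_of_firstPassage_Iio (ha : 0 < a) (hc : IsRightLocallyConstant w)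
    (hw : (range w).Finite) {τ : ℝ≥0∞} (hτ : firstPassage (Iio y) w = τ) (n : ℕ) :
    drawdownTime a y w (n + 1) = τ +
      drawdownTime a (w τ.toNNReal) (fun s => w (τ.toNNReal + s)) (n + 1) := by
  have hb := hw.bddAbove
  have hm : τ ≠ ∞ → max (w τ.toNNReal) (w τ.toNNReal) = runningMax y w τ.toNNReal := by
    intro hne
    lift τ to ℝ≥0 using hne
    rw [ENNReal.toNNReal_coe, max_self, runningMax_eq_max_of_forall_lt hb fun u hu =>
      (mem_of_lt_firstPassage hc (hτ ▸ ENNReal.coe_lt_coe.2 hu) : w u < y).le]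
    exact (max_eq_right (notMem_Iio.1 (notMem_of_firstPassage_eq hc hτ))).symm
  have hvisit : ∀ u : ℝ≥0, runningMax y w u ≤ w u → τ ≤ u := by
    intro u hu
    by_contra! hlt
    exact ((le_max_left _ _).trans hu).not_gt (mem_of_lt_firstPassage hc (hτ ▸ hlt))
  refine drawdownTime_succ_eq_add ha hw hm (le_antisymm (drawdownTimeFrom_mono zero_le) ?_) n
  exact le_drawdownTimeFrom_iff.2 fun u t _ hut hu ht =>
    drawdownTimeFrom_le (hvisit u hu) hut hu ht

theorem firstPassage_Ioc_le_of_drawdown (hc : IsRightLocallyConstant w)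
    (hw : BddAbove (range w)) {t : ℝ≥0} (ht : a ≤ runningMax y w t - w t) :
    firstPassage (Ioc (y - a) y) w ≤ t := by
  by_contra! hlt
  have hM : runningMax y w t = y := by
    rw [runningMax_eq_max_of_forall_lt hw fun u hu =>
      (mem_of_lt_firstPassage hc ((ENNReal.coe_lt_coe.2 hu).trans hlt)).2]
    exact max_eq_left (mem_of_lt_firstPassage hc hlt).2
  have := (mem_of_lt_firstPassage hc hlt).1
  linarith

theorem drawdownTime_succ_of_firstPassage_Ioc_le (ha : 0 < a) (hc : IsRightLocallyConstant w)
    (hw : (range w).Finite) (h0 : w 0 = y) {τ : ℝ≥0∞}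
    (hτ : firstPassage (Ioc (y - a) y) w = τ) (hle : w τ.toNNReal ≤ y - a) (n : ℕ) :
    drawdownTime a y w (n + 1) =
      τ + drawdownTime a y (fun s => w (τ.toNNReal + s)) n := by
  have hb := hw.bddAbove
  have hne : τ ≠ ∞ := by
    rintro rfl
    rw [ENNReal.toNNReal_top, h0] at hle
    linarith
  lift τ to ℝ≥0 using hne
  rw [ENNReal.toNNReal_coe] at hle ⊢
  have hmax : max y (w τ) = y := max_eq_left (hle.trans (sub_le_self y ha.le))
  have hpos : 0 < τ := by
    have h0mem : w 0 ∈ Ioc (y - a) y := ⟨by linarith, h0.le⟩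
    exact_mod_cast hτ ▸ firstPassage_pos hc h0mem
  have hM : runningMax y w τ = y := by
    rw [runningMax_eq_max_of_forall_lt hb fun u hu =>
      (mem_of_lt_firstPassage hc (hτ ▸ ENNReal.coe_lt_coe.2 hu)).2, hmax]
  have hM0 : runningMax y w 0 ≤ w 0 := by
    rw [runningMax_eq_max_of_forall_lt hb fun u hu => absurd hu not_lt_zero, h0, max_self]
  have hone : drawdownTime a y w 1 = τ := by
    rw [drawdownTime_succ ha hw]
    refine le_antisymm (drawdownTimeFrom_le zero_le hpos hM0 ?_) ?_
    · rw [hM]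
      exact le_sub_comm.1 hle
    · exact le_drawdownTimeFrom_iff.2 fun u t _ _ _ ht =>
        hτ ▸ firstPassage_Ioc_le_of_drawdown hc hb ht
  have hadd := drawdownTime_add (k := 1) (j := 0) ha hw (fun _ => hmax.trans hM.symm)
    (hone.trans (add_zero _).symm) n
  rwa [add_comm 1, zero_add] at hadd

theorem drawdownTime_succ_of_lt_firstPassage_Ioc (ha : 0 < a) (hc : IsRightLocallyConstant w)
    (hw : (range w).Finite) {τ : ℝ≥0∞} (hτ : firstPassage (Ioc (y - a) y) w = τ)
    (hlt : y - a < w τ.toNNReal) (n : ℕ) :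
    drawdownTime a y w (n + 1) = τ +
      drawdownTime a (w τ.toNNReal) (fun s => w (τ.toNNReal + s)) (n + 1) := by
  have hb := hw.bddAbove
  have hM : τ ≠ ∞ → runningMax y w τ.toNNReal = w τ.toNNReal := by
    intro hne
    lift τ to ℝ≥0 using hne
    rw [ENNReal.toNNReal_coe] at hlt ⊢
    rw [runningMax_eq_max_of_forall_lt hb fun u hu =>
      (mem_of_lt_firstPassage hc (hτ ▸ ENNReal.coe_lt_coe.2 hu)).2]
    refine max_eq_right (le_of_not_ge fun hle => ?_)
    exact notMem_of_firstPassage_eq hc hτ ⟨hlt, hle⟩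
  have hm : τ ≠ ∞ → max (w τ.toNNReal) (w τ.toNNReal) = runningMax y w τ.toNNReal :=
    fun hne => (max_self _).trans (hM hne).symm
  refine drawdownTime_succ_eq_add ha hw hm (le_antisymm (drawdownTimeFrom_mono zero_le) ?_) n
  refine le_drawdownTimeFrom_iff.2 fun u t _ _ _ ht => ?_
  have hτt : τ ≤ t := hτ ▸ firstPassage_Ioc_le_of_drawdown hc hb ht
  lift τ to ℝ≥0 using (hτt.trans_lt ENNReal.coe_lt_top).ne
  have hMτ := hM ENNReal.coe_ne_top
  rw [ENNReal.toNNReal_coe] at hMτ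
  refine drawdownTimeFrom_le le_rfl (lt_of_le_of_ne (ENNReal.coe_le_coe.1 hτt) ?_) hMτ.le ht
  rintro rfl
  linarith

end Decomposition

section Measurability

variable {Ω : Type*} [MeasurableSpace Ω] {X : Ω → ℝ≥0 → ℝ} {a y : ℝ}

theorem measurable_runningMax (hc : ∀ ω, IsRightLocallyConstant (X ω))
    (hb : ∀ ω, BddAbove (range (X ω))) (hX : ∀ t, Measurable fun ω => X ω t) (t : ℝ≥0) :
    Measurable fun ω => runningMax y (X ω) t := by
  refine measurable_of_Ioi fun c => ?_
  have hsplit : (fun ω => runningMax y (X ω) t) ⁻¹' Ioi c =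
      {_ω | c < y} ∪ ({ω | ∃ u, u < t ∧ c < X ω u} ∪ {ω | c < X ω t}) := by
    ext ω
    simp only [mem_preimage, mem_Ioi, lt_runningMax_iff (hb ω), mem_union, mem_ofPred_eq,
      le_iff_lt_or_eq, or_and_right, exists_or, exists_eq_left]
  rw [hsplit]
  refine (MeasurableSet.const _).union <| MeasurableSet.union
    (measurableSet_exists_of_eventually_nhdsGE (fun ω u hu => ?_) fun u =>
      (MeasurableSet.const _).inter (measurableSet_lt measurable_const (hX u)))
    (measurableSet_lt measurable_const (hX t))
  filter_upwards [hc ω u, mem_nhdsWithin_of_mem_nhds (Iio_mem_nhds hu.1)] with v hv hvt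
  exact ⟨hvt, hv ▸ hu.2⟩

theorem measurable_drawdownTimeFrom (hc : ∀ ω, IsRightLocallyConstant (X ω))
    (hb : ∀ ω, BddAbove (range (X ω))) (hX : ∀ t, Measurable fun ω => X ω t) {δ : Ω → ℝ≥0∞}
    (hδ : Measurable δ) : Measurable fun ω => drawdownTimeFrom a y (X ω) (δ ω) := by
  have hM := measurable_runningMax (y := y) hc hb hX
  refine measurable_of_Iio fun c => ?_
  simp only [preimage, mem_Iio, drawdownTimeFrom_lt_iff]
  refine measurableSet_exists_of_eventually_nhdsGE ?_ fun u =>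
    measurableSet_exists_of_eventually_nhdsGE ?_ fun t => ?_
  · rintro ω u ⟨t, hδu, hut, htc, hu, ht⟩
    filter_upwards [hc ω u, (hc ω).runningMax (hb ω) u, self_mem_nhdsWithin,
      mem_nhdsWithin_of_mem_nhds (Iio_mem_nhds hut)] with v hv hMv huv hvt
    exact ⟨t, hδu.trans (ENNReal.coe_le_coe.2 huv), hvt, htc, hMv.trans_le (hu.trans hv.ge), ht⟩
  · rintro ω t ⟨hδu, hut, htc, hu, ht⟩
    filter_upwards [hc ω t, (hc ω).runningMax (hb ω) t, self_mem_nhdsWithin,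
      mem_nhdsWithin_of_mem_nhds ((ENNReal.continuous_coe.tendsto t).eventually_lt_const htc)]
      with v hv hMv htv hvc
    exact ⟨hδu, hut.trans_le htv, hvc, hu, by rwa [hMv, hv]⟩
  · exact (measurableSet_le hδ measurable_const).inter <| (MeasurableSet.const _).inter <|
      (MeasurableSet.const _).inter <| (measurableSet_le (hM u) (hX u)).inter <|
      measurableSet_le measurable_const ((hM t).sub (hX t))

theorem measurable_drawdownTime (ha : 0 < a) (hc : ∀ ω, IsRightLocallyConstant (X ω))
    (hf : ∀ ω, (range (X ω)).Finite) (hX : ∀ t, Measurable fun ω => X ω t) (n : ℕ) :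
    Measurable fun ω => drawdownTime a y (X ω) n := by
  induction n with
  | zero => exact measurable_const
  | succ n ih =>
    simp only [drawdownTime_succ ha (hf _)]
    exact measurable_drawdownTimeFrom hc (fun ω => (hf ω).bddAbove) hX ih

end Measurability

/-- Stopping times of the right continuation of the filtration `ℱ`, phrased through `ℱ` itself.
First passage times are of this kind, but in general not stopping times of `ℱ`. -/
def IsOptionalTime {Ω : Type*} {m : MeasurableSpace Ω} (ℱ : Filtration ℝ≥0 m)
    (τ : Ω → ℝ≥0∞) : Prop :=
  ∀ c : ℝ≥0, MeasurableSet[ℱ c] {ω | τ ω < c}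

section OptionalTime

variable {Ω : Type*} {m : MeasurableSpace Ω} {ℱ : Filtration ℝ≥0 m}

theorem IsOptionalTime.measurable {τ : Ω → ℝ≥0∞} (hτ : IsOptionalTime ℱ τ) : Measurable τ := by
  refine measurable_of_Iio fun c => ?_
  induction c with
  | top =>
    have hunion : τ ⁻¹' Iio ∞ = ⋃ n : ℕ, {ω | τ ω < (n : ℝ≥0)} := by
      ext ω
      simpa only [mem_preimage, mem_Iio, mem_iUnion, mem_ofPred_eq, lt_top_iff_ne_top] using
        ⟨ENNReal.exists_nat_gt, fun ⟨n, hn⟩ => (hn.trans (ENNReal.natCast_lt_top n)).ne⟩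
    rw [hunion]
    exact MeasurableSet.iUnion fun n => ℱ.le n _ (hτ n)
  | coe c => exact ℱ.le c _ (hτ c)

theorem isOptionalTime_firstPassage {X : Ω → ℝ≥0 → ℝ} {A : Set ℝ}
    (hc : ∀ ω, IsRightLocallyConstant (X ω)) (hX : ∀ t, MeasurableSet[ℱ t] {ω | X ω t ∈ A}) :
    IsOptionalTime ℱ fun ω => firstPassage A (X ω) := fun c => by
  simp only [firstPassage_lt_iff]
  refine @measurableSet_exists_of_eventually_nhdsGE ℝ≥0 _ _ _ _ _ _ Ω (ℱ c) _
    (fun ω t ⟨h0, htc, hA⟩ => ?_) fun t => ?_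
  · filter_upwards [hc ω t, self_mem_nhdsWithin,
      mem_nhdsWithin_of_mem_nhds ((ENNReal.continuous_coe.tendsto t).eventually_lt_const htc)]
      with s hs hts hsc
    exact ⟨h0.trans_le hts, hsc, hs ▸ hA⟩
  · rcases lt_or_ge t c with htc | hct
    · have hA := (ℱ.mono htc.le _ (hX t)).compl
      exact (@MeasurableSet.const Ω (ℱ c) _).inter ((@MeasurableSet.const Ω (ℱ c) _).inter hA)
    · have hempty : {ω | 0 < t ∧ (t : ℝ≥0∞) < c ∧ X ω t ∉ A} = ∅ :=
        eq_empty_of_forall_notMem fun ω h => (ENNReal.coe_lt_coe.1 h.2.1).not_ge hct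
      exact hempty ▸ @MeasurableSet.empty Ω (ℱ c)

end OptionalTime

/-! ### Jump paths -/

/-- The space of right locally constant paths with states in `E`, the sample space of a jump
process, with the σ-algebra generated by the coordinates. -/
abbrev JumpPath (E : Type*) : Type _ :=
  {w : ℝ≥0 → E // IsRightLocallyConstant w}

namespace JumpPath

variable {E : Type*}

/-- The path observed from time `T` on. -/
def shift (T : ℝ≥0) (w : JumpPath E) : JumpPath E :=
  ⟨fun t => w.1 (T + t), w.2.shift T⟩

theorem shift_apply (T t : ℝ≥0) (w : JumpPath E) : (w.shift T).1 t = w.1 (T + t) := rfl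

theorem shift_shift (s t : ℝ≥0) (w : JumpPath E) : (w.shift s).shift t = w.shift (s + t) :=
  Subtype.ext (funext fun u => by simp only [shift_apply, add_assoc])

/-- The paths that pass through the listed states. The times are encoded by their increments, so
that the Markov property can be applied to the head of the list. -/
def cylinder : List (ℝ≥0 × E) → Set (JumpPath E)
  | [] => univ
  | (t, z) :: L => {w | w.1 t = z ∧ w.shift t ∈ cylinder L}

theorem mem_cylinder_cons {t : ℝ≥0} {z : E} {L : List (ℝ≥0 × E)} {w : JumpPath E} :
    w ∈ cylinder ((t, z) :: L) ↔ w.1 t = z ∧ w.shift t ∈ cylinder L := Iff.rfl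

theorem shift_mem_cylinder_cons {s t : ℝ≥0} {z : E} {L : List (ℝ≥0 × E)} {w : JumpPath E} :
    w.shift s ∈ cylinder ((t, z) :: L) ↔ w.1 (s + t) = z ∧ w.shift (s + t) ∈ cylinder L := by
  rw [mem_cylinder_cons, shift_apply, shift_shift]

theorem exists_cylinder_cons_inter {t t' : ℝ≥0} {z z' : E} {L L' : List (ℝ≥0 × E)} (h : t ≤ t')
    (hL : ∃ M, cylinder L ∩ cylinder ((t' - t, z') :: L') = cylinder M) :
    ∃ M, cylinder ((t, z) :: L) ∩ cylinder ((t', z') :: L') = cylinder M := by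
  obtain ⟨M, hM⟩ := hL
  refine ⟨(t, z) :: M, ?_⟩
  ext w
  rw [mem_cylinder_cons, ← hM]
  simp only [mem_inter_iff, mem_cylinder_cons, shift_apply, shift_shift,
    add_tsub_cancel_of_le h, and_assoc]

theorem exists_cylinder_inter (L L' : List (ℝ≥0 × E)) :
    ∃ M, cylinder L ∩ cylinder L' = cylinder M := by
  induction hn : L.length + L'.length using Nat.strong_induction_on generalizing L L' with
  | _ n ih =>
  match L, L' with
  | [], L' => exact ⟨L', univ_inter _⟩
  | L, [] => exact ⟨L, inter_univ _⟩
  | (t, z) :: L, (t', z') :: L' =>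
    simp only [List.length_cons] at hn
    rcases le_total t t' with h | h
    · exact exists_cylinder_cons_inter h (ih _ (by simp only [List.length_cons]; omega) _ _ rfl)
    · rw [inter_comm]
      exact exists_cylinder_cons_inter h (ih _ (by simp only [List.length_cons]; omega) _ _ rfl)

theorem isPiSystem_range_cylinder : IsPiSystem (range (cylinder (E := E))) := by
  rintro _ ⟨L, rfl⟩ _ ⟨L', rfl⟩ -
  obtain ⟨M, hM⟩ := exists_cylinder_inter L L'
  exact ⟨M, hM.symm⟩

theorem eventually_shift_mem_cylinder (w : JumpPath E) (r : ℝ≥0) (L : List (ℝ≥0 × E)) :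
    ∀ᶠ s in 𝓝[≥] r, (w.shift s ∈ cylinder L ↔ w.shift r ∈ cylinder L) := by
  induction L generalizing r with
  | nil => exact Eventually.of_forall fun _ => Iff.rfl
  | cons p L ih =>
    obtain ⟨t, z⟩ := p
    filter_upwards [(tendsto_add_nhdsGE r t).eventually ((w.2 (r + t)).and (ih (r + t)))]
      with s hs
    rw [shift_mem_cylinder_cons, shift_mem_cylinder_cons, hs.1, hs.2]

variable [MeasurableSpace E]

theorem measurable_apply (t : ℝ≥0) : Measurable fun w : JumpPath E => w.1 t :=
  (measurable_pi_apply t).comp measurable_subtype_coe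

theorem measurable_shift (T : ℝ≥0) : Measurable (shift T : JumpPath E → JumpPath E) :=
  Measurable.subtype_mk (measurable_pi_lambda _ fun t => measurable_apply (T + t))

theorem measurableSet_cylinder [MeasurableSingletonClass E] (L : List (ℝ≥0 × E)) :
    MeasurableSet (cylinder L) := by
  induction L with
  | nil => exact MeasurableSet.univ
  | cons p L ih =>
    exact (measurable_apply p.1 (measurableSet_singleton p.2)).inter (measurable_shift p.1 ih)

theorem generateFrom_range_cylinder [Countable E] [MeasurableSingletonClass E] :
    MeasurableSpace.generateFrom (range (cylinder (E := E))) =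
      (inferInstance : MeasurableSpace (JumpPath E)) := by
  refine le_antisymm (MeasurableSpace.generateFrom_le ?_) ?_
  · rintro _ ⟨L, rfl⟩
    exact measurableSet_cylinder L
  · let m := MeasurableSpace.generateFrom (range (cylinder (E := E)))
    have hval : Measurable[m] (Subtype.val : JumpPath E → ℝ≥0 → E) := by
      refine measurable_pi_lambda _ fun t => measurable_to_countable' fun z => ?_
      refine MeasurableSpace.measurableSet_generateFrom ⟨[(t, z)], ?_⟩
      ext w
      exact and_iff_left trivial
    exact hval.comap_le

end JumpPath

/-- The least multiple of `1 / (n + 1)` strictly greater than `r`. -/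
noncomputable def gridTime (n : ℕ) (r : ℝ≥0) : ℝ≥0 := (⌊(n + 1) * r⌋₊ + 1) / (n + 1)

section GridTime

variable (n : ℕ) (r : ℝ≥0)

theorem lt_gridTime : r < gridTime n r := by
  rw [gridTime, lt_div_iff₀ (by positivity), mul_comm]
  exact Nat.lt_floor_add_one _

theorem gridTime_le : gridTime n r ≤ r + 1 / (n + 1) := by
  rw [gridTime, add_div]
  gcongr
  rw [div_le_iff₀ (by positivity), mul_comm]
  exact Nat.floor_le zero_le

theorem gridTime_eq_iff (k : ℕ) :
    gridTime n r = (k + 1) / (n + 1) ↔ k / (n + 1) ≤ r ∧ r < (k + 1) / (n + 1) := by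
  have hn : (0 : ℝ≥0) < n + 1 := by positivity
  rw [gridTime, div_left_inj' hn.ne', add_left_inj, Nat.cast_inj, Nat.floor_eq_iff zero_le,
    div_le_iff₀ hn, lt_div_iff₀ hn, mul_comm r]

theorem tendsto_gridTime : Tendsto (fun n => gridTime n r) atTop (𝓝[≥] r) := by
  refine tendsto_nhdsWithin_iff.2 ⟨?_, Eventually.of_forall fun n => (lt_gridTime n r).le⟩
  refine tendsto_of_tendsto_of_tendsto_of_le_of_le tendsto_const_nhds ?_
    (fun n => (lt_gridTime n r).le) fun n => gridTime_le n r
  have hzero : Tendsto (fun n : ℕ => 1 / ((n : ℝ≥0) + 1)) atTop (𝓝 0) := by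
    exact_mod_cast tendsto_one_div_add_atTop_nhds_zero_nat (𝕜 := ℝ≥0)
  simpa using tendsto_const_nhds.add hzero

theorem measurable_gridTime : Measurable (gridTime n) :=
  Measurable.div_const (Measurable.add_const
    (measurable_from_nat.comp (Nat.measurable_floor.comp (measurable_const.mul measurable_id))) _) _

theorem countable_range_gridTime : (range (gridTime n)).Countable := by
  refine (countable_range fun k : ℕ => ((k : ℝ≥0) + 1) / (n + 1)).mono ?_
  exact range_subset_iff.2 fun r => ⟨⌊((n : ℝ≥0) + 1) * r⌋₊, rfl⟩

end GridTime

theorem inter_setOf_inter_preimage_singleton {Ω : Type*} {p : Ω → ℝ≥0 → Prop} (D : Set Ω)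
    (σ : Ω → ℝ≥0) (r : ℝ≥0) :
    D ∩ {ω | p ω (σ ω)} ∩ σ ⁻¹' {r} = D ∩ σ ⁻¹' {r} ∩ {ω | p ω r} := by
  ext ω
  simp only [mem_inter_iff, mem_ofPred_eq, mem_preimage, mem_singleton_iff]
  exact ⟨fun ⟨⟨hD, hp⟩, hr⟩ => ⟨⟨hD, hr⟩, hr ▸ hp⟩, fun ⟨⟨hD, hr⟩, hp⟩ => ⟨⟨hD, hr ▸ hp⟩, hr⟩⟩

section GridApproximation

variable {Ω : Type*} [MeasurableSpace Ω] {p : Ω → ℝ≥0 → Prop} {ρ : Ω → ℝ≥0}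

theorem measurableSet_setOf_apply_of_countable_range {σ : Ω → ℝ≥0} (hσ : Measurable σ)
    (hc : (range σ).Countable) (hp : ∀ r, MeasurableSet {ω | p ω r}) :
    MeasurableSet {ω | p ω (σ ω)} := by
  have hunion : {ω | p ω (σ ω)} = ⋃ r ∈ range σ, {ω | p ω r} ∩ σ ⁻¹' {r} := by
    ext ω
    simp only [biUnion_range, mem_iUnion]
    refine ⟨fun h => ⟨ω, h, rfl⟩, ?_⟩
    rintro ⟨i, h, hi⟩
    rwa [mem_ofPred_eq, mem_singleton_iff.1 hi]
  rw [hunion]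
  exact .biUnion hc fun r _ => (hp r).inter (hσ (measurableSet_singleton r))

theorem measurableSet_setOf_gridTime (hρ : Measurable ρ) (hp : ∀ r, MeasurableSet {ω | p ω r})
    (n : ℕ) : MeasurableSet {ω | p ω (gridTime n (ρ ω))} :=
  measurableSet_setOf_apply_of_countable_range ((measurable_gridTime n).comp hρ)
    ((countable_range_gridTime n).mono (range_comp_subset_range ρ (gridTime n))) hp

theorem measurableSet_setOf_of_eventually_nhdsGE
    (hev : ∀ ω r, ∀ᶠ s in 𝓝[≥] r, (p ω s ↔ p ω r)) (hρ : Measurable ρ)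
    (hp : ∀ r, MeasurableSet {ω | p ω r}) : MeasurableSet {ω | p ω (ρ ω)} :=
  measurableSet_of_tendsto_indicator atTop (measurableSet_setOf_gridTime hρ hp)
    fun ω => (tendsto_gridTime (ρ ω)).eventually (hev ω (ρ ω))

theorem tendsto_measure_inter_gridTime (μ : Measure Ω) [IsFiniteMeasure μ] {D : Set Ω}
    (hD : MeasurableSet D) (hev : ∀ ω r, ∀ᶠ s in 𝓝[≥] r, (p ω s ↔ p ω r)) (hρ : Measurable ρ)
    (hp : ∀ r, MeasurableSet {ω | p ω r}) :
    Tendsto (fun n => μ (D ∩ {ω | p ω (gridTime n (ρ ω))})) atTop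
      (𝓝 (μ (D ∩ {ω | p ω (ρ ω)}))) :=
  tendsto_measure_of_tendsto_indicator_of_isFiniteMeasure atTop μ
    (fun n => hD.inter (measurableSet_setOf_gridTime hρ hp n)) fun ω =>
      ((tendsto_gridTime (ρ ω)).eventually (hev ω (ρ ω))).mono fun _ h => and_congr_right' h

theorem measure_eq_tsum_inter_preimage_singleton (μ : Measure Ω) {σ : Ω → ℝ≥0}
    (hσ : Measurable σ) (hc : (range σ).Countable) (B : Set Ω) :
    μ B = ∑' r : range σ, μ (B ∩ σ ⁻¹' {↑r}) := by
  have h := tsum_measure_preimage_singleton (μ := μ.restrict B) hc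
    fun r _ => hσ (measurableSet_singleton r)
  rw [preimage_range, Measure.restrict_apply_univ] at h
  rw [← h]
  exact tsum_congr fun r => by
    rw [Measure.restrict_apply (hσ (measurableSet_singleton _)), inter_comm]

end GridApproximation

theorem IsOptionalTime.measurableSet_lt_inter_gridTime_preimage {Ω : Type*} {m : MeasurableSpace Ω}
    {ℱ : Filtration ℝ≥0 m} {τ : Ω → ℝ≥0∞} (hτ : IsOptionalTime ℱ τ) (c : ℝ≥0) (n k : ℕ) :
    MeasurableSet[ℱ ((k + 1) / (n + 1))]
      ({ω | τ ω < c} ∩ (fun ω => gridTime n (τ ω).toNNReal) ⁻¹' {((k : ℝ≥0) + 1) / (n + 1)}) := by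
  have hset : {ω | τ ω < c} ∩
      (fun ω => gridTime n (τ ω).toNNReal) ⁻¹' {((k : ℝ≥0) + 1) / (n + 1)} =
      {ω | τ ω < (min c ((k + 1) / (n + 1)) : ℝ≥0)} \ {ω | τ ω < (k / (n + 1) : ℝ≥0)} := by
    ext ω
    simp only [mem_inter_iff, mem_preimage, mem_singleton_iff, mem_ofPred_eq, Set.mem_sdiff,
      gridTime_eq_iff]
    rcases eq_or_ne (τ ω) ∞ with h | h
    · simp only [h, not_top_lt, false_and]
    · lift τ ω to ℝ≥0 using h with r
      simp only [ENNReal.coe_lt_coe, ENNReal.toNNReal_coe, lt_min_iff, not_lt]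
      tauto
  rw [hset]
  refine (ℱ.mono (min_le_right _ _) _ (hτ _)).diff (ℱ.mono ?_ _ (hτ _))
  gcongr
  exact le_self_add

/-! ### The strong Markov property -/

/-- The time-homogeneous Markov property of the jump process `X` under the laws `P x`, where `P x`
stands for the process started from `x`. The transition probabilities are read off from the laws
themselves: given the past `ℱ s` and `X s = y`, the state at time `s + t` is distributed as the
state at time `t` under `P y`. -/
structure IsMarkovFamily {Ω E : Type*} {m : MeasurableSpace Ω} [MeasurableSpace E]
    (ℱ : Filtration ℝ≥0 m) (P : E → Measure Ω) (X : Ω → JumpPath E) : Prop where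
  prob : ∀ x, IsProbabilityMeasure (P x)
  adapted : ∀ t, Measurable[ℱ t] fun ω => (X ω).1 t
  markov : ∀ (x : E) (s t : ℝ≥0) (A : Set Ω), MeasurableSet[ℱ s] A → ∀ y z : E,
    P x (A ∩ {ω | (X ω).1 s = y} ∩ {ω | (X ω).1 (s + t) = z}) =
      P x (A ∩ {ω | (X ω).1 s = y}) * P y {ω | (X ω).1 t = z}

/-- The event that the random time `τ` is finite and the process is in state `z` at that time. -/
def stoppedAt {Ω E : Type*} (X : Ω → JumpPath E) (τ : Ω → ℝ≥0∞) (z : E) : Set Ω :=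
  {ω | τ ω ≠ ∞ ∧ (X ω).1 (τ ω).toNNReal = z}

namespace IsMarkovFamily

variable {Ω E : Type*} {m : MeasurableSpace Ω} [MeasurableSpace E] {ℱ : Filtration ℝ≥0 m}
  {P : E → Measure Ω} {X : Ω → JumpPath E}

theorem measurable_apply (hX : IsMarkovFamily ℱ P X) (t : ℝ≥0) :
    Measurable fun ω => (X ω).1 t :=
  (hX.adapted t).mono (ℱ.le t) le_rfl

theorem measurable (hX : IsMarkovFamily ℱ P X) : Measurable X :=
  Measurable.subtype_mk (measurable_pi_lambda _ hX.measurable_apply)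

variable [MeasurableSingletonClass E]

theorem measurableSet_apply_eq (hX : IsMarkovFamily ℱ P X) (t : ℝ≥0) (z : E) :
    MeasurableSet[ℱ t] {ω | (X ω).1 t = z} :=
  hX.adapted t (measurableSet_singleton z)

theorem measurableSet_shift_mem_cylinder (hX : IsMarkovFamily ℱ P X) (L : List (ℝ≥0 × E))
    (t : ℝ≥0) : MeasurableSet {ω | (X ω).shift t ∈ JumpPath.cylinder L} :=
  ((JumpPath.measurable_shift t).comp hX.measurable) (JumpPath.measurableSet_cylinder L)

theorem measure_inter_shift_mem_cylinder (hX : IsMarkovFamily ℱ P X) (x : E)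
    (L : List (ℝ≥0 × E)) {s : ℝ≥0} {A : Set Ω} (hA : MeasurableSet[ℱ s] A) (y : E) :
    P x (A ∩ {ω | (X ω).1 s = y} ∩ {ω | (X ω).shift s ∈ JumpPath.cylinder L}) =
      P x (A ∩ {ω | (X ω).1 s = y}) * P y (X ⁻¹' JumpPath.cylinder L) := by
  induction L generalizing x s A y with
  | nil =>
    have := hX.prob y
    simp [JumpPath.cylinder]
  | cons p L ih =>
    obtain ⟨t, z⟩ := p
    have hpast : MeasurableSet[ℱ (s + t)] (A ∩ {ω | (X ω).1 s = y}) :=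
      ℱ.mono le_self_add _ (hA.inter (hX.measurableSet_apply_eq s y))
    calc P x (A ∩ {ω | (X ω).1 s = y} ∩ {ω | (X ω).shift s ∈ JumpPath.cylinder ((t, z) :: L)})
        = P x (A ∩ {ω | (X ω).1 s = y} ∩ {ω | (X ω).1 (s + t) = z} ∩
            {ω | (X ω).shift (s + t) ∈ JumpPath.cylinder L}) := by
          simp only [JumpPath.shift_mem_cylinder_cons, ofPred_and, inter_assoc]
      _ = P x (A ∩ {ω | (X ω).1 s = y}) *
            (P y (univ ∩ {ω | (X ω).1 t = z}) * P z (X ⁻¹' JumpPath.cylinder L)) := by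
          rw [ih x hpast z, hX.markov x s t A hA y z, mul_assoc, univ_inter]
      _ = P x (A ∩ {ω | (X ω).1 s = y}) * P y (X ⁻¹' JumpPath.cylinder ((t, z) :: L)) := by
          rw [← ih y (s := t) MeasurableSet.univ z, univ_inter]
          rfl

theorem measure_inter_shift_mem_cylinder_of_countable_range (hX : IsMarkovFamily ℱ P X)
    {σ : Ω → ℝ≥0} (hσ : Measurable σ) (hc : (range σ).Countable) {D : Set Ω}
    (hD : ∀ r ∈ range σ, MeasurableSet[ℱ r] (D ∩ σ ⁻¹' {r})) (x z : E) (L : List (ℝ≥0 × E)) :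
    P x (D ∩ {ω | (X ω).1 (σ ω) = z ∧ (X ω).shift (σ ω) ∈ JumpPath.cylinder L}) =
      P x (D ∩ {ω | (X ω).1 (σ ω) = z}) * P z (X ⁻¹' JumpPath.cylinder L) := by
  rw [measure_eq_tsum_inter_preimage_singleton _ hσ hc,
    measure_eq_tsum_inter_preimage_singleton _ hσ hc (D ∩ {ω | (X ω).1 (σ ω) = z}),
    ← ENNReal.tsum_mul_right]
  refine tsum_congr fun ⟨r, hr⟩ => ?_
  rw [inter_setOf_inter_preimage_singleton (p := fun ω r => (X ω).1 r = z),
    inter_setOf_inter_preimage_singleton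
      (p := fun ω r => (X ω).1 r = z ∧ (X ω).shift r ∈ JumpPath.cylinder L),
    ofPred_and, ← inter_assoc]
  exact hX.measure_inter_shift_mem_cylinder x L (hD r hr) z

theorem measurable_shift_comp [Countable E] (hX : IsMarkovFamily ℱ P X) {ρ : Ω → ℝ≥0}
    (hρ : Measurable ρ) : Measurable fun ω => (X ω).shift (ρ ω) := by
  refine Measurable.subtype_mk (measurable_pi_lambda _ fun t => ?_)
  refine measurable_to_countable' fun z => ?_
  refine measurableSet_setOf_of_eventually_nhdsGE (p := fun ω r => (X ω).1 (r + t) = z)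
    (fun ω r => ?_) hρ fun r => hX.measurable_apply (r + t) (measurableSet_singleton z)
  filter_upwards [(tendsto_add_nhdsGE r t).eventually ((X ω).2 (r + t))] with s hs
  rw [hs]

theorem measurableSet_stoppedAt (hX : IsMarkovFamily ℱ P X) {τ : Ω → ℝ≥0∞} (hτ : Measurable τ)
    (z : E) : MeasurableSet (stoppedAt X τ z) := by
  refine (hτ (measurableSet_singleton ∞)).compl.inter ?_
  refine measurableSet_setOf_of_eventually_nhdsGE (p := fun ω r => (X ω).1 r = z)
    (fun ω r => ?_) hτ.ennreal_toNNReal fun r => hX.measurable_apply r (measurableSet_singleton z)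
  filter_upwards [(X ω).2 r] with s hs
  rw [hs]

theorem measure_lt_inter_shift_mem_cylinder (hX : IsMarkovFamily ℱ P X) {τ : Ω → ℝ≥0∞}
    (hτ : IsOptionalTime ℱ τ) (x z : E) (c : ℝ≥0) (L : List (ℝ≥0 × E)) :
    P x ({ω | τ ω < c} ∩ {ω | (X ω).1 (τ ω).toNNReal = z ∧
        (X ω).shift (τ ω).toNNReal ∈ JumpPath.cylinder L}) =
      P x ({ω | τ ω < c} ∩ {ω | (X ω).1 (τ ω).toNNReal = z}) * P z (X ⁻¹' JumpPath.cylinder L) := by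
  have := hX.prob
  have hρ := hτ.measurable.ennreal_toNNReal
  have hD : MeasurableSet {ω | τ ω < c} := ℱ.le c _ (hτ c)
  have hat (r : ℝ≥0) : MeasurableSet {ω | (X ω).1 r = z} :=
    hX.measurable_apply r (measurableSet_singleton z)
  -- The grid times decrease to `τ` and take countably many values, so the Markov property at
  -- deterministic times applies to them and survives the limit by right local constancy.
  have hlim := tendsto_measure_inter_gridTime (P x) hD
    (p := fun ω r => (X ω).1 r = z) (fun ω r => ((X ω).2 r).mono fun s hs => by rw [hs]) hρ hat
  have hlim_shift := tendsto_measure_inter_gridTime (P x) hD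
    (p := fun ω r => (X ω).1 r = z ∧ (X ω).shift r ∈ JumpPath.cylinder L)
    (fun ω r => (((X ω).2 r).and ((X ω).eventually_shift_mem_cylinder r L)).mono
      fun s hs => by rw [hs.1, hs.2])
    hρ fun r => (hat r).inter (hX.measurableSet_shift_mem_cylinder L r)
  refine tendsto_nhds_unique hlim_shift ((ENNReal.Tendsto.mul_const hlim
    (Or.inr (measure_ne_top _ _))).congr fun n => ?_)
  refine (hX.measure_inter_shift_mem_cylinder_of_countable_range
    ((measurable_gridTime n).comp hρ)
    ((countable_range_gridTime n).mono (range_comp_subset_range _ (gridTime n))) ?_ x z L).symm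
  rintro _ ⟨ω, rfl⟩
  exact hτ.measurableSet_lt_inter_gridTime_preimage c n ⌊((n : ℝ≥0) + 1) * (τ ω).toNNReal⌋₊

theorem map_shift_eq_prod [Countable E] (hX : IsMarkovFamily ℱ P X) {τ : Ω → ℝ≥0∞}
    (hτ : IsOptionalTime ℱ τ) (x z : E) :
    ((P x).restrict (stoppedAt X τ z)).map
        (fun ω => ((τ ω).toNNReal, (X ω).shift (τ ω).toNNReal)) =
      (((P x).restrict (stoppedAt X τ z)).map fun ω => (τ ω).toNNReal).prod ((P z).map X) := by
  have := hX.prob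
  have hρ := hτ.measurable.ennreal_toNNReal
  have hpair := hρ.prodMk (hX.measurable_shift_comp hρ)
  have := Measure.isProbabilityMeasure_map (μ := P z) hX.measurable.aemeasurable
  have hset (c : ℝ≥0) (B : Set Ω) : (fun ω => (τ ω).toNNReal) ⁻¹' Iio c ∩ B ∩ stoppedAt X τ z =
      {ω | τ ω < c} ∩ ({ω | (X ω).1 (τ ω).toNNReal = z} ∩ B) := by
    ext ω
    simp only [stoppedAt, mem_inter_iff, mem_preimage, mem_Iio, mem_ofPred_eq]
    rcases eq_or_ne (τ ω) ∞ with h | h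
    · simp only [h, ne_eq, not_true_eq_false, false_and, and_false, not_top_lt]
    · lift τ ω to ℝ≥0 using h with r
      simp only [ENNReal.toNNReal_coe, ENNReal.coe_lt_coe, ne_eq, ENNReal.coe_ne_top,
        not_false_eq_true, true_and]
      tauto
  symm
  refine Measure.prod_eq_generateFrom (C := range (Iio : ℝ≥0 → Set ℝ≥0))
    ((borel_eq_generateFrom_Iio ℝ≥0).symm.trans BorelSpace.measurable_eq.symm)
    JumpPath.generateFrom_range_cylinder isPiSystem_Iio
    JumpPath.isPiSystem_range_cylinder
    ⟨fun n => Iio n, fun n => ⟨_, rfl⟩, fun n => measure_lt_top _ _,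
      eq_univ_of_forall fun r => mem_iUnion.2 (exists_nat_gt r)⟩
    ⟨fun _ => univ, fun _ => ⟨[], rfl⟩, fun n => measure_lt_top _ _, iUnion_const _⟩ ?_
  rintro _ ⟨c, rfl⟩ _ ⟨L, rfl⟩
  have hL := JumpPath.measurableSet_cylinder L
  have hrect := measurableSet_Iio.prod hL (s := Iio c)
  rw [Measure.map_apply hpair hrect, Measure.map_apply hρ measurableSet_Iio,
    Measure.map_apply hX.measurable hL, Measure.restrict_apply (hpair hrect),
    Measure.restrict_apply (hρ measurableSet_Iio), mk_preimage_prod, hset,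
    ← inter_univ (_ ⁻¹' Iio c), hset, inter_univ]
  exact hX.measure_lt_inter_shift_mem_cylinder hτ x z c L

theorem setIntegral_stoppedAt_mul_comp_shift [Countable E] {𝕜 : Type*} [RCLike 𝕜]
    (hX : IsMarkovFamily ℱ P X) {τ : Ω → ℝ≥0∞} (hτ : IsOptionalTime ℱ τ) (x z : E)
    {g : ℝ≥0∞ → 𝕜} (hg : Measurable g) {F : JumpPath E → 𝕜} (hF : Measurable F) :
    ∫ ω in stoppedAt X τ z, g (τ ω) * F ((X ω).shift (τ ω).toNNReal) ∂P x =
      (∫ ω in stoppedAt X τ z, g (τ ω) ∂P x) * ∫ ω, F (X ω) ∂P z := by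
  have := hX.prob
  have hρ := hτ.measurable.ennreal_toNNReal
  have hpair := hρ.prodMk (hX.measurable_shift_comp hρ)
  have hg_coe : Measurable fun t : ℝ≥0 => g t := hg.comp measurable_coe_nnreal_ennreal
  have := Measure.isProbabilityMeasure_map (μ := P z) hX.measurable.aemeasurable
  have hcoe (ω : Ω) (hω : ω ∈ stoppedAt X τ z) : g (τ ω) = g (τ ω).toNNReal := by
    rw [ENNReal.coe_toNNReal hω.1]
  have hmeas_stopped := hX.measurableSet_stoppedAt hτ.measurable z
  rw [setIntegral_congr_fun hmeas_stopped hcoe,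
    setIntegral_congr_fun hmeas_stopped fun ω hω => congrArg (· * F _) (hcoe ω hω),
    ← integral_map hρ.aemeasurable hg_coe.aestronglyMeasurable,
    ← integral_map hX.measurable.aemeasurable hF.aestronglyMeasurable, ← integral_prod_mul,
    ← hX.map_shift_eq_prod hτ x z, integral_map hpair.aemeasurable]
  exact ((hg_coe.comp measurable_fst).mul (hF.comp measurable_snd)).aestronglyMeasurable

end IsMarkovFamily

/-! ### Discounted drawdown times -/

section Discount

theorem discount_top (q : ℂ) : discount q ∞ = 0 := if_pos rfl

theorem discount_coe (q : ℂ) (T : ℝ≥0) : discount q T = Complex.exp (-q * T) :=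
  if_neg ENNReal.coe_ne_top

theorem measurable_discount (q : ℂ) : Measurable (discount q) :=
  Measurable.ite (measurableSet_singleton ∞) measurable_const
    (Complex.measurable_exp.comp (measurable_const.mul
      (Complex.measurable_ofReal.comp ENNReal.measurable_toReal)))

theorem discount_add (q : ℂ) (S T : ℝ≥0∞) : discount q (S + T) = discount q S * discount q T := by
  induction S with
  | top => rw [top_add, discount_top, zero_mul]
  | coe S =>
    induction T with
    | top => rw [add_top, discount_top, mul_zero]
    | coe T =>
      rw [← ENNReal.coe_add, discount_coe, discount_coe, discount_coe, ← Complex.exp_add,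
        NNReal.coe_add, Complex.ofReal_add, mul_add]

theorem norm_discount_coe (q : ℂ) (T : ℝ≥0) : ‖discount q T‖ = Real.exp (-(q.re * T)) := by
  rw [discount_coe, Complex.norm_exp, Complex.re_mul_ofReal, Complex.neg_re, neg_mul]

variable {q : ℂ} (hq : 0 < q.re)
include hq

theorem norm_discount_le_one (T : ℝ≥0∞) : ‖discount q T‖ ≤ 1 := by
  induction T with
  | top => simp only [discount_top, norm_zero, zero_le_one]
  | coe T =>
    rw [norm_discount_coe, Real.exp_le_one_iff]
    exact neg_nonpos.2 (by positivity)

theorem norm_discount_lt_one {T : ℝ≥0∞} (hT : 0 < T) : ‖discount q T‖ < 1 := by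
  induction T with
  | top => simp only [discount_top, norm_zero, zero_lt_one]
  | coe T =>
    rw [norm_discount_coe, Real.exp_lt_one_iff]
    exact neg_neg_of_pos (mul_pos hq (ENNReal.coe_pos.1 hT))

variable {Ω : Type*} [MeasurableSpace Ω] (μ : Measure Ω) {τ : Ω → ℝ≥0∞} (hτ : Measurable τ)
include hτ

theorem integrable_discount [IsFiniteMeasure μ] : Integrable (fun ω => discount q (τ ω)) μ :=
  Integrable.of_bound ((measurable_discount q).comp hτ).aestronglyMeasurable 1
    (Eventually.of_forall fun _ => norm_discount_le_one hq _)

theorem integral_norm_discount_le_one [IsProbabilityMeasure μ] :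
    ∫ ω, ‖discount q (τ ω)‖ ∂μ ≤ 1 :=
  (integral_mono (integrable_discount hq μ hτ).norm (integrable_const 1)
    fun _ => norm_discount_le_one hq _).trans_eq (by simp)

theorem integral_norm_discount_lt_one [IsProbabilityMeasure μ] (hpos : ∀ᵐ ω ∂μ, 0 < τ ω) :
    ∫ ω, ‖discount q (τ ω)‖ ∂μ < 1 := by
  obtain ⟨ω, hω, hle⟩ := exists_notMem_null_integral_le (integrable_discount hq μ hτ).norm hpos
  exact hle.trans_lt (norm_discount_lt_one hq (not_not.1 hω))

end Discount

theorem disjoint_stoppedAt {Ω E : Type*} (X : Ω → JumpPath E) (τ : Ω → ℝ≥0∞) :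
    Pairwise (Function.onFun Disjoint (stoppedAt X τ)) :=
  fun _ _ hne => disjoint_left.2 fun _ h h' => hne (h.2.symm.trans h'.2)

namespace IsMarkovFamily

variable {Ω E : Type*} {m : MeasurableSpace Ω} [MeasurableSpace E] [MeasurableSingletonClass E]
  [Fintype E] {ℱ : Filtration ℝ≥0 m} {P : E → Measure Ω} {X : Ω → JumpPath E} {τ : Ω → ℝ≥0∞}

theorem integral_eq_sum_setIntegral_stoppedAt {F : Type*} [NormedAddCommGroup F]
    [NormedSpace ℝ F] (hX : IsMarkovFamily ℱ P X) (hτ : Measurable τ) {x : E} {f : Ω → F}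
    (hf : Integrable f (P x)) (h0 : ∀ᵐ ω ∂P x, τ ω = ∞ → f ω = 0) :
    ∫ ω, f ω ∂P x = ∑ z, ∫ ω in stoppedAt X τ z, f ω ∂P x := by
  rw [← integral_iUnion_fintype (hX.measurableSet_stoppedAt hτ) (disjoint_stoppedAt X τ)
    fun _ => hf.integrableOn]
  refine (setIntegral_eq_integral_of_ae_compl_eq_zero ?_).symm
  filter_upwards [h0] with ω hω hnot
  exact hω (not_not.1 fun hne => hnot (mem_iUnion.2 ⟨_, hne, rfl⟩))

theorem sum_norm_setIntegral_discount_le (hX : IsMarkovFamily ℱ P X) (hτ : Measurable τ)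
    {q : ℂ} (hq : 0 < q.re) (x : E) :
    ∑ z, ‖∫ ω in stoppedAt X τ z, discount q (τ ω) ∂P x‖ ≤ ∫ ω, ‖discount q (τ ω)‖ ∂P x := by
  have := hX.prob x
  rw [hX.integral_eq_sum_setIntegral_stoppedAt hτ (integrable_discount hq (P x) hτ).norm
    (Eventually.of_forall fun ω h => by rw [h, discount_top, norm_zero])]
  exact Finset.sum_le_sum fun z _ => norm_integral_le_integral_norm _

theorem integral_discount_eq_sum (hX : IsMarkovFamily ℱ P X) (hτ : IsOptionalTime ℱ τ)
    {q : ℂ} (hq : 0 < q.re) {x : E} {D : Ω → ℝ≥0∞} (hD : Measurable D)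
    {D' : E → JumpPath E → ℝ≥0∞} (hD' : ∀ z, Measurable (D' z))
    (hrestart : ∀ᵐ ω ∂P x,
      D ω = τ ω + D' ((X ω).1 (τ ω).toNNReal) ((X ω).shift (τ ω).toNNReal)) :
    ∫ ω, discount q (D ω) ∂P x =
      ∑ z, (∫ ω in stoppedAt X τ z, discount q (τ ω) ∂P x) * ∫ ω, discount q (D' z (X ω)) ∂P z := by
  have := hX.prob x
  rw [hX.integral_eq_sum_setIntegral_stoppedAt hτ.measurable (integrable_discount hq (P x) hD)
    (hrestart.mono fun ω h hinf => by rw [h, hinf, top_add, discount_top])]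
  refine Finset.sum_congr rfl fun z _ => ?_
  refine Eq.trans ?_ (hX.setIntegral_stoppedAt_mul_comp_shift hτ x z (measurable_discount q)
    ((measurable_discount q).comp (hD' z)))
  refine setIntegral_congr_ae (hX.measurableSet_stoppedAt hτ.measurable z)
    (hrestart.mono fun ω h hω => ?_)
  rw [h, hω.2, discount_add]
  rfl

end IsMarkovFamily

theorem le_mul_of_le_sum_mul_max {ι : Type*} [Fintype ι] {p : ι → ι → ℝ} {b : ι → ℝ} {ρ C : ℝ}
    (hp : ∀ i j, 0 ≤ p i j) (hρ1 : ρ < 1) (hρ : ∀ i, ∑ j, p i j ≤ ρ) (hC : 0 ≤ C)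
    (hb : ∀ i, b i ≤ ∑ j, p i j * max C (b j)) (i : ι) : b i ≤ ρ * C := by
  have : Nonempty ι := ⟨i⟩
  obtain ⟨k, hk⟩ := Finite.exists_max b
  have hρ0 : 0 ≤ ρ := (Finset.sum_nonneg fun j _ => hp i j).trans (hρ i)
  -- At a maximizer `k` of `b` the unknown values on the right are absorbed by the left side.
  have hbk : b k ≤ ρ * max C (b k) := calc
    b k ≤ ∑ j, p k j * max C (b k) := (hb k).trans (Finset.sum_le_sum fun j _ =>
      mul_le_mul_of_nonneg_left (max_le_max_left C (hk j)) (hp k j))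
    _ ≤ ρ * max C (b k) := by
      rw [← Finset.sum_mul]
      exact mul_le_mul_of_nonneg_right (hρ k) (hC.trans (le_max_left _ _))
  refine (hk i).trans ?_
  rcases le_total (b k) C with h | h
  · rwa [max_eq_left h] at hbk
  · rw [max_eq_right h] at hbk
    have : b k ≤ 0 := by nlinarith
    exact this.trans (mul_nonneg hρ0 hC)

theorem JumpPath.finite_range_coe {S : Finset ℝ} (w : JumpPath S) :
    (range fun t => (w.1 t : ℝ)).Finite :=
  S.finite_toSet.subset (range_subset_iff.2 fun t => (w.1 t).2)

theorem JumpPath.measurable_drawdownTime {S : Finset ℝ} {a : ℝ} (ha : 0 < a) (y : ℝ) (n : ℕ) :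
    Measurable fun w : JumpPath S => drawdownTime a y (fun t => (w.1 t : ℝ)) n :=
  _root_.measurable_drawdownTime ha (fun w => w.2.comp Subtype.val) finite_range_coe
    (fun t => measurable_subtype_coe.comp (JumpPath.measurable_apply t)) n

/-- The first passage time `T_A` of the chain. -/
noncomputable def exitTime {Ω : Type*} {S : Finset ℝ} (Y : ℝ≥0 → Ω → S) (A : Set ℝ) (ω : Ω) :
    ℝ≥0∞ :=
  firstPassage A fun t => (Y t ω : ℝ)

namespace IsCTMC

variable {Ω : Type*} {mΩ : MeasurableSpace Ω} {S : Finset ℝ} {G : Matrix S S ℝ} {P : S → Measure Ω}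
  {Y : ℝ≥0 → Ω → S}

/-- The sample path of the chain as a point of the path space. -/
def path (hY : IsCTMC G P Y) (ω : Ω) : JumpPath S :=
  ⟨fun t => Y t ω, fun t => by
    have h := hY.right_continuous ω t
    rw [ContinuousWithinAt, nhds_discrete] at h
    exact tendsto_pure.1 h⟩

/-- The natural filtration of the chain. -/
def filtration (hY : IsCTMC G P Y) : Filtration ℝ≥0 mΩ where
  seq s := ⨆ u ∈ Iic s, MeasurableSpace.comap (Y u) inferInstance
  mono' _ _ hst := biSup_mono fun _ hu => (mem_Iic.1 hu).trans hst
  le' _ := iSup₂_le fun u _ => (hY.measurable u).comap_le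

theorem measureReal_apply_eq (hY : IsCTMC G P Y) (t : ℝ≥0) (y z : S) :
    (P y).real {ω | Y t ω = z} = NormedSpace.exp ((t : ℝ) • G) y z := by
  have := hY.prob y
  have hstart : {ω | Y 0 ω = y} =ᵐ[P y] (univ : Set Ω) := eventuallyEq_univ.2 (hY.start y)
  have hinter := measureReal_congr (inter_ae_eq_right_of_ae_eq_univ (t := {ω | Y t ω = z}) hstart)
  have h := hY.markov y 0 t univ MeasurableSet.univ y z
  rwa [univ_inter, zero_add, hinter, measureReal_congr hstart, probReal_univ, one_mul] at h

theorem isMarkovFamily (hY : IsCTMC G P Y) : IsMarkovFamily hY.filtration P hY.path where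
  prob := hY.prob
  adapted t := measurable_iff_comap_le.2
    (le_biSup (fun u => MeasurableSpace.comap (Y u) inferInstance) self_mem_Iic)
  markov x s t A hA y z := by
    have := hY.prob
    have h := hY.markov x s t A hA y z
    rw [← hY.measureReal_apply_eq] at h
    simp only [measureReal_def, ← ENNReal.toReal_mul] at h
    exact (ENNReal.toReal_eq_toReal_iff' (measure_ne_top _ _)
      (ENNReal.mul_ne_top (measure_ne_top _ _) (measure_ne_top _ _))).1 h

theorem isRightLocallyConstant (hY : IsCTMC G P Y) (ω : Ω) :
    IsRightLocallyConstant fun t => (Y t ω : ℝ) :=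
  (hY.path ω).2.comp Subtype.val

theorem isOptionalTime_exitTime (hY : IsCTMC G P Y) (A : Set ℝ) :
    IsOptionalTime hY.filtration (exitTime Y A) :=
  isOptionalTime_firstPassage hY.isRightLocallyConstant fun t =>
    hY.isMarkovFamily.adapted t (toFinite {z : S | (z : ℝ) ∈ A}).measurableSet

theorem passageTransform_pointIndicator (hY : IsCTMC G P Y) (A : Set ℝ) (q : ℂ) (x z : S) :
    passageTransform P Y A (fun _ => q) x (pointIndicator z) =
      ∫ ω in stoppedAt hY.path (exitTime Y A) z, discount q (exitTime Y A ω) ∂P x := by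
  rw [← integral_indicator (hY.isMarkovFamily.measurableSet_stoppedAt
    (hY.isOptionalTime_exitTime A).measurable z)]
  refine integral_congr_ae (Eventually.of_forall fun ω => ?_)
  change (if exitTime Y A ω = ∞ then 0
    else Complex.exp (-∫ _ in (0 : ℝ)..(exitTime Y A ω).toReal, q) *
      pointIndicator z (Y (exitTime Y A ω).toNNReal ω)) = _
  by_cases hinf : exitTime Y A ω = ∞
  · rw [if_pos hinf, indicator_of_notMem fun hmem => hmem.1 hinf]
  · by_cases hz : Y (exitTime Y A ω).toNNReal ω = z
    · rw [if_neg hinf, indicator_of_mem (show ω ∈ stoppedAt hY.path _ z from ⟨hinf, hz⟩),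
        pointIndicator, if_pos hz, discount, if_neg hinf, mul_one, intervalIntegral.integral_const,
        sub_zero, Complex.real_smul, neg_mul, mul_comm]
    · rw [if_neg hinf, indicator_of_notMem fun hmem => hz hmem.2, pointIndicator, if_neg hz,
        mul_zero]

theorem passageTransform_pointIndicator_of_mem (hY : IsCTMC G P Y) {A : Set ℝ} (q : ℂ) (x : S)
    {z : S} (hz : (z : ℝ) ∈ A) :
    passageTransform P Y A (fun _ => q) x (pointIndicator z) = 0 := by
  have hempty : stoppedAt hY.path (exitTime Y A) z = ∅ := by
    refine eq_empty_of_forall_notMem ?_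
    rintro ω ⟨hne, rfl⟩
    exact notMem_of_firstPassage_eq (hY.isRightLocallyConstant ω)
      (ENNReal.coe_toNNReal hne).symm hz
  rw [hY.passageTransform_pointIndicator, hempty, setIntegral_empty]

section Discount

variable (hY : IsCTMC G P Y) {q : ℂ} (hq : 0 < q.re)
include hY hq

theorem sum_norm_passageTransform_le_one (A : Set ℝ) (x : S) :
    ∑ z, ‖passageTransform P Y A (fun _ => q) x (pointIndicator z)‖ ≤ 1 := by
  have := hY.prob x
  have hτ := (hY.isOptionalTime_exitTime A).measurable
  simp only [hY.passageTransform_pointIndicator]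
  exact (hY.isMarkovFamily.sum_norm_setIntegral_discount_le hτ hq x).trans
    (integral_norm_discount_le_one hq (P x) hτ)

theorem sum_norm_passageTransform_lt_one {A : Set ℝ} {x : S} (hx : (x : ℝ) ∈ A) :
    ∑ z, ‖passageTransform P Y A (fun _ => q) x (pointIndicator z)‖ < 1 := by
  have := hY.prob x
  have hτ := (hY.isOptionalTime_exitTime A).measurable
  simp only [hY.passageTransform_pointIndicator]
  refine (hY.isMarkovFamily.sum_norm_setIntegral_discount_le hτ hq x).trans_lt
    (integral_norm_discount_lt_one hq (P x) hτ ?_)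
  filter_upwards [hY.start x] with ω hω
  exact firstPassage_pos (hY.isRightLocallyConstant ω) (by rwa [hω])

variable {a : ℝ} (ha : 0 < a)
include ha

theorem integrable_drawdownDiscount (x y : S) (n : ℕ) :
    Integrable (drawdownDiscount Y a q y n) (P x) :=
  have := hY.prob x
  integrable_discount hq (P x)
    ((JumpPath.measurable_drawdownTime ha y n).comp hY.isMarkovFamily.measurable)

theorem integral_drawdownDiscount_eq_sum (A : Set ℝ) (x y : S) (n : ℕ) (m : S → S) (k : S → ℕ)
    (hrestart : ∀ᵐ ω ∂P x, drawdownTime a y (fun t => (Y t ω : ℝ)) n =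
      exitTime Y A ω + drawdownTime a (m (Y (exitTime Y A ω).toNNReal ω))
        (fun t => (Y ((exitTime Y A ω).toNNReal + t) ω : ℝ)) (k (Y (exitTime Y A ω).toNNReal ω))) :
    ∫ ω, drawdownDiscount Y a q y n ω ∂P x =
      ∑ z, passageTransform P Y A (fun _ => q) x (pointIndicator z) *
        ∫ ω, drawdownDiscount Y a q (m z) (k z) ω ∂P z := by
  simp only [hY.passageTransform_pointIndicator]
  exact hY.isMarkovFamily.integral_discount_eq_sum (hY.isOptionalTime_exitTime A) hq
    ((JumpPath.measurable_drawdownTime ha y n).comp hY.isMarkovFamily.measurable)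
    (D' := fun z w => drawdownTime a (m z) (fun t => (w.1 t : ℝ)) (k z))
    (fun z => JumpPath.measurable_drawdownTime ha (m z) (k z)) hrestart

theorem norm_integral_drawdownDiscount_le_one (x y : S) (n : ℕ) :
    ‖∫ ω, drawdownDiscount Y a q y n ω ∂P x‖ ≤ 1 := by
  have := hY.prob x
  exact (norm_integral_le_integral_norm _).trans (integral_norm_discount_le_one hq (P x)
    ((JumpPath.measurable_drawdownTime ha y n).comp hY.isMarkovFamily.measurable))

theorem integral_drawdownDiscount_succ_eq_sum_Iio (x y : S) (n : ℕ) :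
    ∫ ω, drawdownDiscount Y a q y (n + 1) ω ∂P x =
      ∑ z, passageTransform P Y (Iio (y : ℝ)) (fun _ => q) x (pointIndicator z) *
        ∫ ω, drawdownDiscount Y a q z (n + 1) ω ∂P z :=
  hY.integral_drawdownDiscount_eq_sum hq ha (Iio (y : ℝ)) x y (n + 1) id (fun _ => n + 1)
    (Eventually.of_forall fun ω => drawdownTime_succ_of_firstPassage_Iio ha
      (hY.isRightLocallyConstant ω) (hY.path ω).finite_range_coe rfl n)

theorem integral_drawdownDiscount_succ_eq_sum_Ioc (y : S) (n : ℕ) :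
    ∫ ω, drawdownDiscount Y a q y (n + 1) ω ∂P y =
      ∑ z, passageTransform P Y (Ioc (y - a : ℝ) y) (fun _ => q) y (pointIndicator z) *
        if (z : ℝ) ≤ y - a then ∫ ω, drawdownDiscount Y a q y n ω ∂P z
        else ∫ ω, drawdownDiscount Y a q z (n + 1) ω ∂P z := by
  refine (hY.integral_drawdownDiscount_eq_sum hq ha (Ioc (y - a : ℝ) y) y y (n + 1)
    (fun z => if (z : ℝ) ≤ y - a then y else z) (fun z => if (z : ℝ) ≤ y - a then n else n + 1)
    ?_).trans (Finset.sum_congr rfl fun z _ => by split_ifs <;> rfl)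
  filter_upwards [hY.start y] with ω hstart
  have hc := hY.isRightLocallyConstant ω
  have hf := (hY.path ω).finite_range_coe
  by_cases hle : (Y (exitTime Y (Ioc (y - a : ℝ) y) ω).toNNReal ω : ℝ) ≤ y - a
  · simp only [if_pos hle]
    exact drawdownTime_succ_of_firstPassage_Ioc_le ha hc hf (congrArg _ hstart) rfl hle n
  · simp only [if_neg hle]
    exact drawdownTime_succ_of_lt_firstPassage_Ioc ha hc hf rfl (not_le.1 hle) n

theorem norm_integral_drawdownDiscount_le_of_forall_self {n : ℕ} {C : ℝ} (hC : 0 ≤ C)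
    (h : ∀ z : S, ‖∫ ω, drawdownDiscount Y a q z (n + 1) ω ∂P z‖ ≤ C) (x y : S) :
    ‖∫ ω, drawdownDiscount Y a q y (n + 1) ω ∂P x‖ ≤ C := by
  rw [hY.integral_drawdownDiscount_succ_eq_sum_Iio hq ha]
  calc
    _ ≤ ∑ z, ‖passageTransform P Y (Iio (y : ℝ)) (fun _ => q) x (pointIndicator z)‖ * C :=
      norm_sum_le_of_le _ fun z _ => (norm_mul _ _).trans_le (by gcongr; exact h z)
    _ ≤ 1 * C := by
      rw [← Finset.sum_mul]
      gcongr
      exact hY.sum_norm_passageTransform_le_one hq _ x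
    _ = C := one_mul C

theorem exists_sum_norm_passageTransform_Ioc_le : ∃ ρ : ℝ, 0 ≤ ρ ∧ ρ < 1 ∧ ∀ y : S,
    ∑ z, ‖passageTransform P Y (Ioc (y - a : ℝ) y) (fun _ => q) y (pointIndicator z)‖ ≤ ρ := by
  have hlt (y : S) := hY.sum_norm_passageTransform_lt_one hq (A := Ioc (y - a : ℝ) y)
    ⟨sub_lt_self _ ha, le_rfl⟩
  have hle := eventually_all.2 fun y =>
    (Ico_mem_nhdsLT (hlt y) : ∀ᶠ ρ in 𝓝[<] (1 : ℝ), ρ ∈ Ico _ 1)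
  have hnonneg : ∀ᶠ ρ in 𝓝[<] (1 : ℝ), ρ ∈ Ico 0 1 := Ico_mem_nhdsLT zero_lt_one
  obtain ⟨ρ, ⟨h0, h1⟩, hρ⟩ := (hnonneg.and hle).exists
  exact ⟨ρ, h0, h1, fun y => (hρ y).1⟩

theorem exists_norm_integral_drawdownDiscount_succ_le_pow : ∃ ρ : ℝ, 0 ≤ ρ ∧ ρ < 1 ∧
    ∀ (n : ℕ) (x y : S), ‖∫ ω, drawdownDiscount Y a q y (n + 1) ω ∂P x‖ ≤ ρ ^ n := by
  obtain ⟨ρ, h0, h1, hρ⟩ := hY.exists_sum_norm_passageTransform_Ioc_le hq ha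
  refine ⟨ρ, h0, h1, fun n => ?_⟩
  induction n with
  | zero => exact fun x y => hY.norm_integral_drawdownDiscount_le_one hq ha x y 1
  | succ n ih =>
    refine hY.norm_integral_drawdownDiscount_le_of_forall_self hq ha (pow_nonneg h0 _) ?_
    rw [pow_succ']
    refine le_mul_of_le_sum_mul_max (fun _ _ => norm_nonneg _) h1 hρ (pow_nonneg h0 n) fun y => ?_
    rw [hY.integral_drawdownDiscount_succ_eq_sum_Ioc hq ha]
    refine norm_sum_le_of_le _ fun z _ => (norm_mul _ _).trans_le ?_
    gcongr
    split_ifs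
    · exact (ih z y).trans (le_max_left _ _)
    · exact le_max_right _ _

theorem summable_integral_drawdownDiscount_succ (x y : S) :
    Summable fun n : ℕ => ∫ ω, drawdownDiscount Y a q y (n + 1) ω ∂P x := by
  obtain ⟨ρ, h0, h1, h⟩ := hY.exists_norm_integral_drawdownDiscount_succ_le_pow hq ha
  exact .of_norm_bounded (summable_geometric_of_lt_one h0 h1) fun n => h n x y

theorem hasSum_drawdownSum (x y : S) :
    HasSum (fun n : ℕ => ∫ ω, drawdownDiscount Y a q y (n + 1) ω ∂P x)
      (drawdownSum P Y a q x y) :=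
  (hY.summable_integral_drawdownDiscount_succ hq ha x y).hasSum

theorem hasSum_one_add_drawdownSum (x y : S) :
    HasSum (fun n : ℕ => ∫ ω, drawdownDiscount Y a q y n ω ∂P x)
      (1 + drawdownSum P Y a q x y) := by
  have := hY.prob x
  have hzero : ∫ ω, drawdownDiscount Y a q y 0 ω ∂P x = 1 := by
    simp [drawdownDiscount, drawdownTime, discount]
  rw [← hzero]
  exact (hY.hasSum_drawdownSum hq ha x y).zero_add

theorem drawdownSum_eq_sum_Iio (x y : S) :
    drawdownSum P Y a q x y =
      ∑ z, passageTransform P Y (Iio (y : ℝ)) (fun _ => q) x (pointIndicator z) *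
        drawdownSum P Y a q z z := by
  refine (hY.hasSum_drawdownSum hq ha x y).unique ?_
  simp only [hY.integral_drawdownDiscount_succ_eq_sum_Iio hq ha x y]
  exact hasSum_sum fun z _ => (hY.hasSum_drawdownSum hq ha z z).mul_left _

theorem drawdownSum_self_eq_sum_Ioc (y : S) :
    drawdownSum P Y a q y y =
      ∑ z, passageTransform P Y (Ioc (y - a : ℝ) y) (fun _ => q) y (pointIndicator z) *
        if (z : ℝ) ≤ y - a then 1 + drawdownSum P Y a q z y else drawdownSum P Y a q z z := by
  refine (hY.hasSum_drawdownSum hq ha y y).unique ?_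
  simp only [hY.integral_drawdownDiscount_succ_eq_sum_Ioc hq ha y]
  refine hasSum_sum fun z _ => HasSum.mul_left _ ?_
  split_ifs
  · exact hY.hasSum_one_add_drawdownSum hq ha z y
  · exact hY.hasSum_drawdownSum hq ha z z

end Discount

theorem sum_passageTransform_Iio_mul (hY : IsCTMC G P Y) (q : ℂ) (x y : S) (f : S → ℂ) :
    ∑ z, passageTransform P Y (Iio (y : ℝ)) (fun _ => q) x (pointIndicator z) * f z =
      ∑ z ∈ Finset.univ.filter (fun z : S => (y : ℝ) ≤ z),
        passageTransform P Y (Iio (y : ℝ)) (fun _ => q) x (pointIndicator z) * f z := by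
  refine (Finset.sum_filter_of_ne fun z _ hz => not_lt.1 fun hlt => hz ?_).symm
  rw [hY.passageTransform_pointIndicator_of_mem q x (mem_Iio.2 hlt), zero_mul]

theorem sum_passageTransform_Ioc_mul_ite (hY : IsCTMC G P Y) {a : ℝ} (ha : 0 < a) (q : ℂ)
    (x y : S) (f g : S → ℂ) :
    ∑ z, passageTransform P Y (Ioc (y - a : ℝ) y) (fun _ => q) x (pointIndicator z) *
        (if (z : ℝ) ≤ y - a then f z else g z) =
      ∑ z ∈ Finset.univ.filter (fun z : S => (z : ℝ) ≤ y - a),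
        passageTransform P Y (Ioc (y - a : ℝ) y) (fun _ => q) x (pointIndicator z) * f z +
      ∑ z ∈ Finset.univ.filter (fun z : S => (y : ℝ) < z),
        passageTransform P Y (Ioc (y - a : ℝ) y) (fun _ => q) x (pointIndicator z) * g z := by
  simp only [mul_ite, Finset.sum_ite]
  congr 1
  refine (Finset.sum_subset ?_ fun z hz hz' => ?_).symm
  · exact Finset.monotone_filter_right _ fun z _ hlt =>
      not_le.2 ((sub_lt_self _ ha).trans hlt)
  · simp only [Finset.mem_filter_univ, not_le, not_lt] at hz hz'
    rw [hY.passageTransform_pointIndicator_of_mem q x (mem_Ioc.2 ⟨hz, hz'⟩), zero_mul]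

end IsCTMC

theorem mainTheorem8 {Ω : Type*} [MeasurableSpace Ω] (S : Finset ℝ) (G : Matrix S S ℝ)
    (hG : IsRateMatrix G) (P : S → Measure Ω) (Y : ℝ≥0 → Ω → S) (hY : IsCTMC G P Y)
    (a : ℝ) (ha : 0 < a) (q : ℂ) (hq : 0 < q.re) :
    (∀ x y : S, (∀ n : ℕ, Integrable (drawdownDiscount Y a q y (n + 1)) (P x)) ∧
      Summable (fun n : ℕ => ∫ ω, drawdownDiscount Y a q y (n + 1) ω ∂(P x))) ∧
    (∀ x y : S, drawdownSum P Y a q x y =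
      ∑ z ∈ Finset.univ.filter (fun z : S => (y : ℝ) ≤ z),
        passageTransform P Y (Iio (y : ℝ)) (fun _ => q) x (pointIndicator z) *
          drawdownSum P Y a q z z) ∧
    (∀ y : S, drawdownSum P Y a q y y =
      (∑ z ∈ Finset.univ.filter (fun z : S => (z : ℝ) ≤ y - a),
        passageTransform P Y (Ioc (y - a : ℝ) y) (fun _ => q) y (pointIndicator z) *
          (1 + drawdownSum P Y a q z y)) +
      ∑ z ∈ Finset.univ.filter (fun z : S => (y : ℝ) < z),
        passageTransform P Y (Ioc (y - a : ℝ) y) (fun _ => q) y (pointIndicator z) *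
          drawdownSum P Y a q z z) := by
  refine ⟨fun x y => ⟨fun n => hY.integrable_drawdownDiscount hq ha x y (n + 1),
    hY.summable_integral_drawdownDiscount_succ hq ha x y⟩, fun x y => ?_, fun y => ?_⟩
  · rw [hY.drawdownSum_eq_sum_Iio hq ha, hY.sum_passageTransform_Iio_mul]
  · rw [hY.drawdownSum_self_eq_sum_Ioc hq ha, hY.sum_passageTransform_Ioc_mul_ite ha]
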